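/- **Setting.** Let $p\le m$. Consider the port-Hamiltonian plant with state $x=(x_1,x_2)\in\mathbb{R}^m\times\mathbb{R}^p$, input $u\in\mathbb{R}^m$ and a constant matched disturbance $d_1\in\mathbb{R}^m$ only, $$\dot x_1=(J_1-R_1)\nabla_{x_1}H+J_{12}\nabla_{x_2}H+u-d_1,\qquad \dot x_2=-J_{12}^\top\nabla_{x_1}H+(J_2-R_2)\nabla_{x_2}H,$$ where $J_1,J_2,R_1,R_2,J_{12}$ are matrices depending smoothly on $x$ with $J_1=-J_1^\top$, $J_2=-J_2^\top$, $R_1=R_1^\top>0$, $R_2=R_2^\top\ge 0$, and $H:\mathbb{R}^{m+p}\to\mathbb{R}$ is smooth with a strict (global) minimum at $(x_1^*,x_2^*)$. It is closed with the controller with state $\zeta\in\mathbb{R}^p$, $$u=(J_1-R_1)\nabla_{x_1}\big[H_c(E^\top x_1-\zeta)\big],\qquad \dot\zeta=E^\top J_{12}\nabla_{x_2}H,$$ where $E\in\mathbb{R}^{m\times p}$ is constant of full rank and $H_c:\mathbb{R}^p\to\mathbb{R}$ is strictly convex, twice continuously differentiable, with $\nabla H_c:\mathbb{R}^p\to\mathbb{R}^p$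 invertible. Put $H_{cl}(x_1,x_2,\zeta)=H(x_1,x_2)+H_c(E^\top x_1-\zeta)$. **Assumptions.** (1) $J_{12}(x)$ and $R_1(x)$ have full rank for all $x$; (2) $\nabla_{x_1x_2}H=0$; (3) $H$ is strongly convex; (4) $J_1$ and $R_1$ are constant; and, for a vector $\bar x_1\in\mathbb{R}^m$, with $J_{12}^{*}:=J_{12}(\bar x_1,x_2^*)$: (5) for all $x$, $E^\top J_{12}(x)$ is invertible and $(J_{12}^{*\top}E)^{-1}J_{12}^{*\top}=(J_{12}(x)^\top E)^{-1}J_{12}(x)^\top$; (6) $\bar x_1$ is the unique solution $x_1$ of $$\nabla_{x_1}H(x_1,x_2^*)=\big\{I-E\,(J_{12}^\top E)^{-1}J_{12}^\top\big\}(J_1-R_1)^{-1}d_1,\qquad J_{12}=J_{12}(x_1,x_2^*).$$ **Conclusion.** There is $\bar\zeta\in\mathbb{R}^p$ such that $(\bar x_1,x_2^*,\bar\zeta)$ is the unique point at which $$\nabla_{x_1}H_{cl}=(J_1-R_1)^{-1}d_1,\quad \nabla_{x_2}H_{cl}=0,\quad \nabla_\zeta H_{cl}=-(J_{12}^{*\top}E)^{-1}J_{12}^{*\top}(J_1-R_1)^{-1}d_1,$$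 and $(\bar x_1,x_2^*,\bar\zeta)$ is a globally asymptotically stable equilibrium of the closed loop: it is an equilibrium, every initial state has a solution on $[0,\infty)$, it is Lyapunov stable, and every solution on $[0,\infty)$ converges to it. Consequently $\nabla_{x_2}H\to 0$ along every solution on $[0,\infty)$. -/

import Mathlib

open Set Filter Topology Matrix
open scoped ContDiff

/-- The Euclidean space of dimension `n`. -/
abbrev Vec (n : ℕ) : Type := EuclideanSpace ℝ (Fin n)

/-- The product of a real matrix and a vector, as a vector of Euclidean space. -/
noncomputable def mulE {k n : ℕ} (A : Matrix (Fin k) (Fin n) ℝ) (v : Vec n) : Vec k :=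
  WithLp.toLp 2 (A *ᵥ (WithLp.ofLp v))

/-- Port-Hamiltonian plants with state `(x₁, x₂)`, `dim x₁ = m`, `dim x₂ = p ≤ m`: the
interconnection matrices `J₁`, `J₁₂`, `J₂` and the dissipation matrices `R₁`, `R₂` (all of them
depending smoothly on the state), and the smooth Hamiltonian `H` with its strict (global)
minimum at `(x₁s, x₂s)`. -/
structure PHPlant (m p : ℕ) where
  J₁ : Vec m × Vec p → Matrix (Fin m) (Fin m) ℝ
  R₁ : Vec m × Vec p → Matrix (Fin m) (Fin m) ℝ
  J₁₂ : Vec m × Vec p → Matrix (Fin m) (Fin p) ℝ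
  J₂ : Vec m × Vec p → Matrix (Fin p) (Fin p) ℝ
  R₂ : Vec m × Vec p → Matrix (Fin p) (Fin p) ℝ
  H : Vec m × Vec p → ℝ
  x₁s : Vec m
  x₂s : Vec p
  dim_le : p ≤ m
  skew_J₁ : ∀ x, J₁ x = -(J₁ x)ᵀ
  skew_J₂ : ∀ x, J₂ x = -(J₂ x)ᵀ
  posDef_R₁ : ∀ x, (R₁ x).PosDef
  posSemidef_R₂ : ∀ x, (R₂ x).PosSemidef
  smooth_J₁ : ∀ i j, ContDiff ℝ ∞ fun x => J₁ x i j
  smooth_R₁ : ∀ i j, ContDiff ℝ ∞ fun x => R₁ x i j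
  smooth_J₁₂ : ∀ i j, ContDiff ℝ ∞ fun x => J₁₂ x i j
  smooth_J₂ : ∀ i j, ContDiff ℝ ∞ fun x => J₂ x i j
  smooth_R₂ : ∀ i j, ContDiff ℝ ∞ fun x => R₂ x i j
  smooth_H : ContDiff ℝ ∞ H
  strict_min : ∀ x, x ≠ (x₁s, x₂s) → H (x₁s, x₂s) < H x

namespace PHPlant

variable {m p : ℕ}

/-- The partial gradient `∇_{x₁} H`. -/
noncomputable def grad₁ (S : PHPlant m p) (x : Vec m × Vec p) : Vec m :=
  gradient (fun y : Vec m => S.H (y, x.2)) x.1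

/-- The partial gradient `∇_{x₂} H`, which is the non-passive output. -/
noncomputable def grad₂ (S : PHPlant m p) (x : Vec m × Vec p) : Vec p :=
  gradient (fun y : Vec p => S.H (x.1, y)) x.2

/-- The right-hand side of the plant with matched disturbance `d₁`, unmatched disturbance `d₂`
and input `u`:
`ẋ₁ = (J₁ - R₁) ∇_{x₁} H + J₁₂ ∇_{x₂} H + u - d₁`,
`ẋ₂ = -J₁₂ᵀ ∇_{x₁} H + (J₂ - R₂) ∇_{x₂} H - d₂`. -/
noncomputable def field (S : PHPlant m p) (d₁ : Vec m) (d₂ : Vec p) (u : Vec m)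
    (x : Vec m × Vec p) : Vec m × Vec p :=
  (mulE (S.J₁ x - S.R₁ x) (S.grad₁ x) + mulE (S.J₁₂ x) (S.grad₂ x) + u - d₁,
    mulE (-(S.J₁₂ x)ᵀ) (S.grad₁ x) + mulE (S.J₂ x - S.R₂ x) (S.grad₂ x) - d₂)

/-- The Hamiltonian has no cross term: `∇_{x₁ x₂} H = 0`, the derivative with respect to `x₂`
of `∇_{x₁} H` vanishes identically. -/
def NoCrossTerm (S : PHPlant m p) : Prop :=
  ∀ (x₁ : Vec m) (x₂ : Vec p), fderiv ℝ (fun y : Vec p => S.grad₁ (x₁, y)) x₂ = 0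

/-- The Hamiltonian is strongly convex, for some modulus `μ > 0`. (All norms on the finite
dimensional state space being equivalent, the choice of the norm only affects `μ`.) -/
def StronglyConvex (S : PHPlant m p) : Prop :=
  ∃ μ : ℝ, 0 < μ ∧ StrongConvexOn univ μ S.H

end PHPlant

/-- The data of an integral controller: a constant full rank `m × p` matrix `E` and a
strictly convex, twice continuously differentiable function `Hc` on `ℝᵖ` whose gradient is an
invertible map of `ℝᵖ` to itself. -/
structure IntegralController (m p : ℕ) where
  E : Matrix (Fin m) (Fin p) ℝ
  Hc : Vec p → ℝ
  rank_E : E.rank = p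
  contDiff_Hc : ContDiff ℝ 2 Hc
  strictConvex_Hc : StrictConvexOn ℝ univ Hc
  bijective_grad : Function.Bijective (gradient Hc)

/-- The state `(x₁, x₂, ζ)` of the closed loop. -/
abbrev CLState (m p : ℕ) : Type := Vec m × Vec p × Vec p

section ClosedLoop

variable {m p : ℕ}

/-- The control law `u = (J₁ - R₁) ∇_{x₁} (Hc (Eᵀ x₁ - ζ))`, the gradient being that of
`x₁ ↦ Hc (Eᵀ x₁ - ζ)`. -/
noncomputable def controlLaw (S : PHPlant m p) (C : IntegralController m p)
    (w : CLState m p) : Vec m :=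
  mulE (S.J₁ (w.1, w.2.1) - S.R₁ (w.1, w.2.1))
    (gradient (fun y : Vec m => C.Hc (mulE C.Eᵀ y - w.2.2)) w.1)

/-- The right-hand side of the closed loop: the plant with `u` given by the control law,
together with `ζ̇ = Eᵀ J₁₂ ∇_{x₂} H`. -/
noncomputable def closedLoop (S : PHPlant m p) (C : IntegralController m p)
    (d₁ : Vec m) (d₂ : Vec p) (w : CLState m p) : CLState m p :=
  ((S.field d₁ d₂ (controlLaw S C w) (w.1, w.2.1)).1,
    (S.field d₁ d₂ (controlLaw S C w) (w.1, w.2.1)).2,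
    mulE (C.Eᵀ * S.J₁₂ (w.1, w.2.1)) (S.grad₂ (w.1, w.2.1)))

/-- The closed-loop Hamiltonian `Hcl (x₁, x₂, ζ) = H (x₁, x₂) + Hc (Eᵀ x₁ - ζ)`. -/
noncomputable def Hcl (S : PHPlant m p) (C : IntegralController m p) (w : CLState m p) : ℝ :=
  S.H (w.1, w.2.1) + C.Hc (mulE C.Eᵀ w.1 - w.2.2)

/-- The gradient `(∇_{x₁} Hcl, ∇_{x₂} Hcl, ∇_ζ Hcl)` of the closed-loop Hamiltonian. -/
noncomputable def gradHcl (S : PHPlant m p) (C : IntegralController m p) (w : CLState m p) :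
    CLState m p :=
  (gradient (fun y : Vec m => Hcl S C (y, w.2.1, w.2.2)) w.1,
    gradient (fun y : Vec p => Hcl S C (w.1, y, w.2.2)) w.2.1,
    gradient (fun y : Vec p => Hcl S C (w.1, w.2.1, y)) w.2.2)

/-- The matrix `(J₁₂ᵀ E)⁻¹ J₁₂ᵀ` at the plant state `x`. -/
noncomputable def leftInv (S : PHPlant m p) (C : IntegralController m p) (x : Vec m × Vec p) :
    Matrix (Fin p) (Fin m) ℝ :=
  ((S.J₁₂ x)ᵀ * C.E)⁻¹ * (S.J₁₂ x)ᵀ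

/-- The equation for the first component `x₁` of an equilibrium, everything being evaluated at
`(x₁, x₂s)`: `∇_{x₁} H = (I - E (J₁₂ᵀ E)⁻¹ J₁₂ᵀ) (J₁ - R₁)⁻¹ d₁`. -/
def EquilibriumEquation (S : PHPlant m p) (C : IntegralController m p) (d₁ x₁ : Vec m) : Prop :=
  S.grad₁ (x₁, S.x₂s) =
    mulE ((1 - C.E * leftInv S C (x₁, S.x₂s)) *
      (S.J₁ (x₁, S.x₂s) - S.R₁ (x₁, S.x₂s))⁻¹) d₁

/-- The prescribed gradient of `Hcl` at the equilibrium, the matrices being evaluated at `x`: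
`((J₁ - R₁)⁻¹ d₁, 0, -(J₁₂ᵀ E)⁻¹ J₁₂ᵀ (J₁ - R₁)⁻¹ d₁)`. -/
noncomputable def equilibriumGradient (S : PHPlant m p) (C : IntegralController m p)
    (d₁ : Vec m) (x : Vec m × Vec p) : CLState m p :=
  (mulE (S.J₁ x - S.R₁ x)⁻¹ d₁, 0, -mulE (leftInv S C x * (S.J₁ x - S.R₁ x)⁻¹) d₁)

end ClosedLoop

/-- `w` solves the autonomous equation `ẇ = f w` on `[0, ∞)`. -/
def IsForwardSolution {V : Type*} [NormedAddCommGroup V] [NormedSpace ℝ V]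
    (f : V → V) (w : ℝ → V) : Prop :=
  ∀ t : ℝ, 0 ≤ t → HasDerivWithinAt w (f (w t)) (Ici 0) t

/-- `a` is a globally asymptotically stable equilibrium of `ẇ = f w`: it is an equilibrium, every
initial state has a solution on `[0, ∞)`, `a` is Lyapunov stable, and all solutions converge
to `a`. -/
def GloballyAsymptoticallyStable {V : Type*} [NormedAddCommGroup V] [NormedSpace ℝ V]
    (f : V → V) (a : V) : Prop :=
  f a = 0 ∧
  (∀ w₀ : V, ∃ w : ℝ → V, IsForwardSolution f w ∧ w 0 = w₀) ∧
  (∀ ε : ℝ, 0 < ε → ∃ δ : ℝ, 0 < δ ∧ ∀ w : ℝ → V, IsForwardSolution f w →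
    dist (w 0) a < δ → ∀ t : ℝ, 0 ≤ t → dist (w t) a < ε) ∧
  (∀ w : ℝ → V, IsForwardSolution f w → Tendsto w atTop (𝓝 a))

/-!
The shifted closed-loop Hamiltonian
`W (x₁, x₂, ζ) = H (x₁, x₂) + Hc (Eᵀ x₁ - ζ) - ⟪b, x₁⟫ + ⟪h, ζ⟫`, with `b = (J₁ - R₁)⁻¹ d₁`,
`h = L b` and `L = (J₁₂ᵀ E)⁻¹ J₁₂ᵀ` (a constant left inverse of `E`), is a Lyapunov function for the
closed loop. It is strictly convex, because `H` and `Hc` are and `(x₁, x₂, ζ) ↦ (x₁, x₂, Eᵀ x₁ - ζ)`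
is injective, and its critical points are the states at which `∇ Hcl = (b, 0, -h)`. Such a state
exists since `∇ Hc` is onto. By convexity it is therefore the only critical point, a strict global
minimum, and the sublevel sets of `W` are bounded (`ConvexOn.isBounded_sublevel`).

As `J₁` and `J₂` are skew and `J₁₂ᵀ E L = J₁₂ᵀ`, along the closed loop
`Ẇ = -⟪q, R₁ q⟫ - ⟪∇_{x₂} H, R₂ ∇_{x₂} H⟫ ≤ 0` with `q = ∇_{x₁} H + E ∇ Hc - b`
(`fderiv_shiftedHcl_closedLoop`). If `W` is constant along a solution, then `q = 0`, so
`Eᵀ x₁ - ζ` is constant, hence so is `∇_{x₁} H = b - E ∇ Hc`, and so is `x₁`. This gives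
`J₁₂ ∇_{x₂} H = 0`, so `∇_{x₂} H = 0` and `x₂` is constant. Then `J₁₂ᵀ ∇_{x₁} H = 0`, and applying
`L` to `q = 0` gives `∇ Hc = h`: the solution starts at the critical point of `W`
(`fderiv_shiftedHcl_eq_zero_of_const`). LaSalle's principle
(`globallyAsymptoticallyStable_of_lyapunov`) concludes. It is proved with global solutions obtained
by cutting off the field outside a sublevel set, and with the invariance of `ω`-limit sets, which is
Grönwall's inequality.
-/

/-! ### Critical points and sublevel sets of convex functions -/

section Convexity

variable {V : Type*} [NormedAddCommGroup V] [NormedSpace ℝ V]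

theorem ConvexOn.le_of_hasFDerivAt_zero {g : V → ℝ} (hg : ConvexOn ℝ univ g) {a : V}
    (ha : HasFDerivAt g (0 : V →L[ℝ] ℝ) a) (x : V) : g a ≤ g x := by
  have hc : ConvexOn ℝ univ (g ∘ AffineMap.lineMap (k := ℝ) a x) := by
    simpa using hg.comp_affineMap (AffineMap.lineMap (k := ℝ) a x)
  have hd : HasDerivAt (g ∘ AffineMap.lineMap (k := ℝ) a x) 0 0 := by
    have h1 : HasDerivAt (AffineMap.lineMap (k := ℝ) a x) (x - a) 0 :=
      AffineMap.hasDerivAt_lineMap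
    have h2 : HasFDerivAt g (0 : V →L[ℝ] ℝ) (AffineMap.lineMap (k := ℝ) a x 0) := by simpa using ha
    simpa using h2.comp_hasDerivAt (0 : ℝ) h1
  have := hc.le_slope_of_hasDerivAt (mem_univ (0 : ℝ)) (mem_univ 1) zero_lt_one hd
  simpa [slope_def_field] using this

/-- A critical point of a strictly convex function is its strict global minimum. -/
theorem StrictConvexOn.lt_of_hasFDerivAt_zero {g : V → ℝ} (hg : StrictConvexOn ℝ univ g) {a : V}
    (ha : HasFDerivAt g (0 : V →L[ℝ] ℝ) a) {x : V} (hx : x ≠ a) : g a < g x := by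
  have hle := hg.convexOn.le_of_hasFDerivAt_zero ha
  refine (hle x).lt_of_ne fun h => hx ?_
  exact hg.eq_of_isMinOn (fun y _ => by simpa [← h] using hle y) (fun y _ => hle y)
    (mem_univ _) (mem_univ _)

/-- A strictly convex function has an injective derivative. -/
theorem StrictConvexOn.eq_of_hasFDerivAt {g : V → ℝ} (hg : StrictConvexOn ℝ univ g) {x y : V}
    {l : V →L[ℝ] ℝ} (hx : HasFDerivAt g l x) (hy : HasFDerivAt g l y) : x = y := by
  have hs : StrictConvexOn ℝ univ (fun z => g z + (-l) z) :=
    hg.add_convexOn ((-l).toLinearMap.convexOn convex_univ)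
  have hx' : HasFDerivAt (fun z => g z + (-l) z) (0 : V →L[ℝ] ℝ) x := by
    exact (add_neg_cancel l) ▸ hx.add (-l).hasFDerivAt
  have hy' : HasFDerivAt (fun z => g z + (-l) z) (0 : V →L[ℝ] ℝ) y := by
    exact (add_neg_cancel l) ▸ hy.add (-l).hasFDerivAt
  by_contra hne
  exact lt_asymm (hs.lt_of_hasFDerivAt_zero hx' (Ne.symm hne)) (hs.lt_of_hasFDerivAt_zero hy' hne)

/-- In finite dimension, a convex function with a strict minimum is coercive: it grows at least
linearly, with the slope `c` it attains on the unit sphere around the minimizer. -/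
theorem ConvexOn.isBounded_sublevel [FiniteDimensional ℝ V] {g : V → ℝ}
    (hg : ConvexOn ℝ univ g) (hcont : Continuous g) {a : V} (hmin : ∀ x, x ≠ a → g a < g x)
    (C : ℝ) : Bornology.IsBounded {x | g x ≤ C} := by
  obtain ⟨c, hc, hcs⟩ : ∃ c : ℝ, 0 < c ∧ ∀ y ∈ Metric.sphere a 1, g a + c ≤ g y := by
    rcases (Metric.sphere a (1 : ℝ)).eq_empty_or_nonempty with he | hne
    · exact ⟨1, one_pos, by simp [he]⟩
    · obtain ⟨y, hy, hymin⟩ := (isCompact_sphere a (1 : ℝ)).exists_isMinOn hne hcont.continuousOn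
      have hya : y ≠ a := by
        rintro rfl
        simp at hy
      exact ⟨g y - g a, sub_pos.2 (hmin y hya), fun z hz => by simpa using hymin hz⟩
  refine (Metric.isBounded_closedBall (x := a) (r := max 1 ((C - g a) / c))).subset fun x hx => ?_
  rw [Metric.mem_closedBall, dist_eq_norm]
  rcases le_or_gt ‖x - a‖ 1 with h1 | h1
  · exact h1.trans (le_max_left _ _)
  refine le_trans ?_ (le_max_right _ _)
  have hr : 0 < ‖x - a‖ := by linarith
  have hinv : ‖x - a‖⁻¹ ≤ 1 := inv_le_one_of_one_le₀ h1.le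
  have hy : a + ‖x - a‖⁻¹ • (x - a) ∈ Metric.sphere a 1 := by
    rw [mem_sphere_iff_norm, add_sub_cancel_left, norm_smul, norm_inv, norm_norm,
      inv_mul_cancel₀ hr.ne']
  have h2 := hg.2 (mem_univ a) (mem_univ x) (sub_nonneg.2 hinv) (inv_nonneg.2 hr.le)
    (sub_add_cancel _ _)
  have h3 : (1 - ‖x - a‖⁻¹) • a + ‖x - a‖⁻¹ • x = a + ‖x - a‖⁻¹ • (x - a) := by
    module
  rw [h3, smul_eq_mul, smul_eq_mul] at h2
  have h4 := hcs _ hy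
  have h5 : g x ≤ C := hx
  rw [le_div_iff₀ hc]
  have h6 : c ≤ ‖x - a‖⁻¹ * (g x - g a) := by linarith
  calc ‖x - a‖ * c ≤ ‖x - a‖ * (‖x - a‖⁻¹ * (g x - g a)) := by gcongr
    _ = g x - g a := by field_simp
    _ ≤ C - g a := by linarith

end Convexity

/-! ### Autonomous equations and the invariance principle -/

section ODE

variable {V : Type*} [NormedAddCommGroup V] [NormedSpace ℝ V] {f : V → V} {w : ℝ → V}

namespace IsForwardSolution

theorem continuousOn (hw : IsForwardSolution f w) : ContinuousOn w (Ici 0) :=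
  fun t ht => (hw t ht).continuousWithinAt

theorem hasDerivWithinAt_Ici (hw : IsForwardSolution f w) {t : ℝ} (ht : 0 ≤ t) :
    HasDerivWithinAt w (f (w t)) (Ici t) t :=
  (hw t ht).mono (Ici_subset_Ici.2 ht)

theorem shift (hw : IsForwardSolution f w) {s : ℝ} (hs : 0 ≤ s) :
    IsForwardSolution f fun t => w (s + t) := by
  intro t ht
  have h1 : HasDerivWithinAt (fun t : ℝ => s + t) 1 (Ici 0) t :=
    ((hasDerivAt_id t).const_add s).hasDerivWithinAt
  have h2 := (hw (s + t) (by positivity)).scomp t h1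
    (fun r (hr : 0 ≤ r) => mem_Ici.2 (by positivity))
  exact (one_smul ℝ (f (w (s + t)))) ▸ h2

theorem comp_hasDerivWithinAt (hw : IsForwardSolution f w) {F : Type*} [NormedAddCommGroup F]
    [NormedSpace ℝ F] {g : V → F} (hg : Differentiable ℝ g) {t : ℝ} (ht : 0 ≤ t) :
    HasDerivWithinAt (fun s => g (w s)) (fderiv ℝ g (w t) (f (w t))) (Ici 0) t :=
  (hg (w t)).hasFDerivAt.comp_hasDerivWithinAt t (hw t ht)

/-- If a function is constant along a solution, its derivative along the field vanishes there. -/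
theorem fderiv_apply_eq_zero (hw : IsForwardSolution f w) {F : Type*} [NormedAddCommGroup F]
    [NormedSpace ℝ F] {g : V → F} (hg : Differentiable ℝ g) {c : F}
    (hc : ∀ t, 0 ≤ t → g (w t) = c) {t : ℝ} (ht : 0 ≤ t) :
    fderiv ℝ g (w t) (f (w t)) = 0 :=
  (uniqueDiffOn_Ici (0 : ℝ) t ht).eq_deriv (Ici 0) (hw.comp_hasDerivWithinAt hg ht)
    ((hasDerivWithinAt_const t (Ici 0) c).congr (fun s hs => hc s hs) (hc t ht))

theorem map_field_eq_zero (hw : IsForwardSolution f w) {F : Type*} [NormedAddCommGroup F]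
    [NormedSpace ℝ F] (g : V →L[ℝ] F) {c : F} (hc : ∀ t, 0 ≤ t → g (w t) = c) {t : ℝ}
    (ht : 0 ≤ t) : g (f (w t)) = 0 := by
  simpa using hw.fderiv_apply_eq_zero g.differentiable hc ht

theorem map_eq_of_map_field_eq_zero (hw : IsForwardSolution f w) {F : Type*}
    [NormedAddCommGroup F] [NormedSpace ℝ F] (g : V →L[ℝ] F)
    (hc : ∀ t, 0 ≤ t → g (f (w t)) = 0) {t : ℝ} (ht : 0 ≤ t) : g (w t) = g (w 0) := by
  refine constant_of_has_deriv_right_zero (f := fun s => g (w s)) (a := 0) (b := t)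
    (g.continuous.comp_continuousOn (hw.continuousOn.mono Icc_subset_Ici_self))
    (fun s hs => ?_) t ⟨ht, le_rfl⟩
  rw [← hc s hs.1]
  exact g.hasFDerivAt.comp_hasDerivWithinAt s (hw.hasDerivWithinAt_Ici hs.1)

theorem antitoneOn (hw : IsForwardSolution f w) {W : V → ℝ} (hW : Differentiable ℝ W)
    (hdec : ∀ x, fderiv ℝ W x (f x) ≤ 0) : AntitoneOn (fun t => W (w t)) (Ici 0) := by
  have hd : ∀ t ∈ interior (Ici (0 : ℝ)), HasDerivAt (fun t => W (w t))
      (fderiv ℝ W (w t) (f (w t))) t := fun t ht => by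
    rw [interior_Ici] at ht
    exact (hw.comp_hasDerivWithinAt hW (le_of_lt ht)).hasDerivAt (Ici_mem_nhds ht)
  exact antitoneOn_of_deriv_nonpos (convex_Ici 0)
    (fun t ht => (hw.comp_hasDerivWithinAt hW ht).continuousWithinAt)
    (fun t ht => (hd t ht).differentiableAt.differentiableWithinAt)
    (fun t ht => (hd t ht).deriv.trans_le (hdec _))

end IsForwardSolution

/-- A bounded Lipschitz field has global forward solutions: the Picard–Lindelöf solutions on
`[0, n]` agree where they overlap. -/
theorem exists_isForwardSolution_of_lipschitzWith [CompleteSpace V] {K L : NNReal}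
    (hf : LipschitzWith K f) (hL : ∀ x, ‖f x‖ ≤ L) (w₀ : V) :
    ∃ w : ℝ → V, IsForwardSolution f w ∧ w 0 = w₀ := by
  have hex : ∀ n : ℕ, ∃ α : ℝ → V, α 0 = w₀ ∧ ∀ t ∈ Icc (0 : ℝ) n,
      HasDerivWithinAt α (f (α t)) (Icc 0 (n : ℝ)) t := fun n => by
    have hpl : IsPicardLindelof (fun _ => f) (⟨0, left_mem_Icc.2 n.cast_nonneg⟩ : Icc (0 : ℝ) n)
        w₀ (L * n) 0 L K :=
      { lipschitzOnWith := fun _ _ => hf.lipschitzOnWith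
        continuousOn := fun _ _ => continuousOn_const
        norm_le := fun _ _ x _ => hL x
        mul_max_le := by simp }
    exact hpl.exists_eq_forall_mem_Icc_hasDerivWithinAt₀
  choose α hα0 hα using hex
  have hIci : ∀ (n : ℕ) (t : ℝ), t ∈ Ico (0 : ℝ) n →
      HasDerivWithinAt (α n) (f (α n t)) (Ici t) t := fun n t ht =>
    (hα n t (Ico_subset_Icc_self ht)).mono_of_mem_nhdsWithin
      (mem_of_superset (Icc_mem_nhdsGE ht.2) (Icc_subset_Icc_left ht.1))
  have heq : ∀ (n k : ℕ) (t : ℝ), 0 ≤ t → t ≤ n → t ≤ k → α n t = α k t := by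
    intro n k t ht hn hk
    have := dist_le_of_trajectories_ODE (v := fun _ => f) (K := K) (δ := 0) (a := 0) (b := t)
      (f := α n) (g := α k) (fun _ => hf)
      (fun s hs => (hα n s ⟨hs.1, hs.2.trans hn⟩).continuousWithinAt.mono
        (Icc_subset_Icc_right hn))
      (fun s hs => hIci n s ⟨hs.1, hs.2.trans_le hn⟩)
      (fun s hs => (hα k s ⟨hs.1, hs.2.trans hk⟩).continuousWithinAt.mono
        (Icc_subset_Icc_right hk))
      (fun s hs => hIci k s ⟨hs.1, hs.2.trans_le hk⟩) (by simp [hα0]) t ⟨ht, le_rfl⟩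
    exact dist_le_zero.1 (by simpa using this)
  have hceil : ∀ t : ℝ, t < ((⌈t⌉₊ + 1 : ℕ) : ℝ) := fun t => by
    push_cast
    linarith [Nat.le_ceil t]
  refine ⟨fun t => α (⌈t⌉₊ + 1) t, fun t ht => ?_, hα0 _⟩
  have hd := (hα (⌈t⌉₊ + 1) t ⟨ht, (hceil t).le⟩).congr
    (f₁ := fun t => α (⌈t⌉₊ + 1) t) (fun s hs => heq _ _ s hs.1 (hceil s).le hs.2) rfl
  refine hd.mono_of_mem_nhdsWithin ?_
  rw [← Ici_inter_Iic]
  exact inter_mem self_mem_nhdsWithin (mem_nhdsWithin_of_mem_nhds (Iic_mem_nhds (hceil t)))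

/-- A `C¹` field with a nonincreasing function with bounded sublevel sets has global forward
solutions. The field is cut off outside a ball containing the sublevel set of the initial state;
`W` is nonincreasing along the cut off field too, so its solutions never leave that ball. -/
theorem exists_isForwardSolution_of_lyapunov [FiniteDimensional ℝ V] {W : V → ℝ}
    (hf : ContDiff ℝ 1 f) (hW : Differentiable ℝ W)
    (hbdd : ∀ c, Bornology.IsBounded {x | W x ≤ c}) (hdec : ∀ x, fderiv ℝ W x (f x) ≤ 0)
    (w₀ : V) : ∃ w : ℝ → V, IsForwardSolution f w ∧ w 0 = w₀ := by
  have : CompleteSpace V := FiniteDimensional.complete ℝ V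
  obtain ⟨R, hR, hsub⟩ := (hbdd (W w₀)).subset_closedBall_lt 0 0
  let χ : ContDiffBump (0 : V) := ⟨R, R + 1, hR, by linarith⟩
  let g : V → V := fun x => χ x • f x
  have hg : ContDiff ℝ 1 g := χ.contDiff.smul hf
  have hgs : HasCompactSupport g := χ.hasCompactSupport.smul_right
  obtain ⟨K, hK⟩ := hg.lipschitzWith_of_hasCompactSupport hgs one_ne_zero
  obtain ⟨L, hL⟩ := hgs.exists_bound_of_continuous hg.continuous
  obtain ⟨w, hw, hw0⟩ := exists_isForwardSolution_of_lipschitzWith hK (L := L.toNNReal)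
    (fun x => (hL x).trans (Real.le_coe_toNNReal L)) w₀
  refine ⟨w, fun t ht => ?_, hw0⟩
  have hanti := hw.antitoneOn hW fun x => by
    simpa [g] using mul_nonpos_of_nonneg_of_nonpos χ.nonneg (hdec x)
  have hmem : w t ∈ Metric.closedBall (0 : V) R :=
    hsub (by simpa [hw0] using hanti (mem_Ici.2 le_rfl) (mem_Ici.2 ht) ht)
  have hone : g (w t) = f (w t) := by
    simp only [g]
    rw [χ.one_of_mem_closedBall hmem, one_smul]
  exact hone ▸ hw t ht

/-- Forward invariance of the `ω`-limit set: if `y` is a cluster point of a bounded solution, then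
so is every later point of a bounded solution starting at `y`, by Grönwall's inequality. -/
theorem IsForwardSolution.mapClusterPt_of_mapClusterPt [FiniteDimensional ℝ V]
    (hf : ContDiff ℝ 1 f) (hw : IsForwardSolution f w) {φ : ℝ → V} (hφ : IsForwardSolution f φ)
    {B : Set V} (hB : Bornology.IsBounded B) (hwB : ∀ t, 0 ≤ t → w t ∈ B)
    (hφB : ∀ t, 0 ≤ t → φ t ∈ B) (hy : MapClusterPt (φ 0) atTop w) {s : ℝ} (hs : 0 ≤ s) :
    MapClusterPt (φ s) atTop w := by
  have : ProperSpace V := FiniteDimensional.proper ℝ V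
  obtain ⟨R, hR⟩ := hB.subset_closedBall (0 : V)
  obtain ⟨K, hK⟩ := (hf.contDiffOn (s := Metric.closedBall (0 : V) R)).exists_lipschitzOnWith
    one_ne_zero (convex_closedBall _ _) (isCompact_closedBall _ _)
  rw [Metric.nhds_basis_ball.mapClusterPt_iff_frequently] at hy ⊢
  intro ε hε
  have hexp : 0 < Real.exp (K * s) := Real.exp_pos _
  -- Grönwall's inequality on `[0, s]` magnifies distances by at most `exp (K * s)`.
  have hδ : 0 < ε / 2 / Real.exp (K * s) := by positivity
  rw [frequently_atTop]
  intro T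
  obtain ⟨t, ht, hty⟩ := frequently_atTop.1 (hy _ hδ) (max T 0)
  have ht0 : 0 ≤ t := (le_max_right _ _).trans ht
  refine ⟨t + s, by linarith [(le_max_left T 0).trans ht], ?_⟩
  have hsh := hw.shift ht0
  have := dist_le_of_trajectories_ODE_of_mem (v := fun _ => f) (K := K)
    (s := fun _ => Metric.closedBall (0 : V) R) (δ := ε / 2 / Real.exp (K * s)) (a := 0) (b := s)
    (f := fun r => w (t + r)) (g := φ) (fun _ _ => hK)
    (hsh.continuousOn.mono Icc_subset_Ici_self) (fun r hr => hsh.hasDerivWithinAt_Ici hr.1)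
    (fun r hr => hR (hwB _ (add_nonneg ht0 hr.1)))
    (hφ.continuousOn.mono Icc_subset_Ici_self) (fun r hr => hφ.hasDerivWithinAt_Ici hr.1)
    (fun r hr => hR (hφB _ hr.1)) (by simpa using (Metric.mem_ball.1 hty).le) s ⟨hs, le_rfl⟩
  rw [sub_zero, div_mul_cancel₀ _ hexp.ne'] at this
  exact Metric.mem_ball.2 (this.trans_lt (half_lt_self hε))

/-- **LaSalle's invariance principle** in the form of a criterion for global asymptotic
stability: `W` need not decrease strictly, as long as every solution along which it is constant
starts at `a`. -/
theorem globallyAsymptoticallyStable_of_lyapunov [FiniteDimensional ℝ V] {W : V → ℝ} {a : V}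
    (hf : ContDiff ℝ 1 f) (hfa : f a = 0) (hW : Differentiable ℝ W)
    (hbdd : ∀ c, Bornology.IsBounded {x | W x ≤ c}) (hmin : ∀ x, x ≠ a → W a < W x)
    (hdec : ∀ x, fderiv ℝ W x (f x) ≤ 0)
    (hinv : ∀ φ : ℝ → V, IsForwardSolution f φ → (∀ t, 0 ≤ t → W (φ t) = W (φ 0)) → φ 0 = a) :
    GloballyAsymptoticallyStable f a := by
  have : ProperSpace V := FiniteDimensional.proper ℝ V
  have hcpt : ∀ c, IsCompact {x | W x ≤ c} := fun c =>
    Metric.isCompact_of_isClosed_isBounded (isClosed_le hW.continuous continuous_const) (hbdd c)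
  have hex := exists_isForwardSolution_of_lyapunov hf hW hbdd hdec
  have hle : ∀ w, IsForwardSolution f w → ∀ t, 0 ≤ t → W (w t) ≤ W (w 0) := fun w hw t ht =>
    hw.antitoneOn hW hdec (mem_Ici.2 le_rfl) (mem_Ici.2 ht) ht
  refine ⟨hfa, hex, fun ε hε => ?_, fun w hw => ?_⟩
  · -- Some sublevel set of `W` around `a` lies in the `ε`-ball.
    obtain ⟨c, hc, hcε⟩ : ∃ c, W a < c ∧ ∀ x, W x < c → dist x a < ε := by
      have hK : IsCompact ({x | W x ≤ W a + 1} ∩ (Metric.ball a ε)ᶜ) :=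
        (hcpt _).inter_right Metric.isOpen_ball.isClosed_compl
      rcases ({x | W x ≤ W a + 1} ∩ (Metric.ball a ε)ᶜ).eq_empty_or_nonempty with he | hne
      · refine ⟨W a + 1, by linarith, fun x hx => ?_⟩
        by_contra hd
        exact (Set.eq_empty_iff_forall_notMem.1 he x) ⟨le_of_lt hx, hd⟩
      · obtain ⟨y, hy, hymin⟩ := hK.exists_isMinOn hne hW.continuous.continuousOn
        have hya : y ≠ a := by
          rintro rfl
          exact hy.2 (Metric.mem_ball_self hε)
        refine ⟨W y, hmin y hya, fun x hx => ?_⟩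
        by_contra hd
        exact not_lt.2 (hymin ⟨hx.le.trans hy.1, hd⟩) hx
    obtain ⟨δ, hδ, hδc⟩ := Metric.eventually_nhds_iff.1
      (hW.continuous.continuousAt.eventually_lt_const hc)
    exact ⟨δ, hδ, fun w hw hw0 t ht => hcε _ ((hle w hw t ht).trans_lt (hδc hw0))⟩
  · have hmem : ∀ t, 0 ≤ t → w t ∈ {x | W x ≤ W (w 0)} := hle w hw
    have hWa : ∀ x, W a ≤ W x := fun x => by
      rcases eq_or_ne x a with rfl | h
      · exact le_rfl
      · exact (hmin x h).le
    obtain ⟨l, hl⟩ : ∃ l, Tendsto (fun t => W (w t)) atTop (𝓝 l) := by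
      have hanti : Antitone fun t => W (w (max t 0)) := fun s t hst =>
        hw.antitoneOn hW hdec (le_max_right s 0) (le_max_right t 0) (max_le_max_right 0 hst)
      refine ⟨_, (tendsto_atTop_ciInf hanti ⟨W a, ?_⟩).congr' ?_⟩
      · rintro _ ⟨t, rfl⟩
        exact hWa _
      · filter_upwards [eventually_ge_atTop 0] with t ht
        rw [max_eq_left ht]
    -- All cluster points lie on one level of `W`, and by invariance so does the solution from any
    -- of them.
    have hcl : ∀ y, MapClusterPt y atTop w → W y = l := fun y hy =>
      eq_of_nhds_neBot (ClusterPt.mono (hy.continuousAt_comp hW.continuous.continuousAt) hl)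
    refine (hcpt (W (w 0))).tendsto_nhds_of_unique_mapClusterPt
      ((eventually_ge_atTop 0).mono hmem) fun y hyK hy => ?_
    obtain ⟨φ, hφ, rfl⟩ := hex y
    have hφK : ∀ t, 0 ≤ t → φ t ∈ {x | W x ≤ W (w 0)} := fun t ht =>
      (hle φ hφ t ht).trans hyK
    refine hinv φ hφ fun t ht => ?_
    rw [hcl _ hy, hcl _ (hw.mapClusterPt_of_mapClusterPt hf hφ (hbdd _) hmem hφK hy ht)]

end ODE

/-! ### Matrices acting on Euclidean space -/

section MulE

variable {k l n : ℕ}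

/-- Multiplication by a matrix, as a continuous linear map of Euclidean spaces. -/
noncomputable def mulCLM (A : Matrix (Fin k) (Fin n) ℝ) : Vec n →L[ℝ] Vec k :=
  LinearMap.toContinuousLinearMap (Matrix.toEuclideanLin A)

@[simp] theorem mulCLM_apply (A : Matrix (Fin k) (Fin n) ℝ) (v : Vec n) :
    mulCLM A v = mulE A v := rfl

@[simp] theorem mulE_zero (A : Matrix (Fin k) (Fin n) ℝ) : mulE A 0 = 0 :=
  map_zero (mulCLM A)

theorem mulE_add (A : Matrix (Fin k) (Fin n) ℝ) (v w : Vec n) :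
    mulE A (v + w) = mulE A v + mulE A w := map_add (mulCLM A) v w

theorem mulE_sub (A : Matrix (Fin k) (Fin n) ℝ) (v w : Vec n) :
    mulE A (v - w) = mulE A v - mulE A w := map_sub (mulCLM A) v w

theorem sub_mulE (A B : Matrix (Fin k) (Fin n) ℝ) (v : Vec n) :
    mulE (A - B) v = mulE A v - mulE B v := by
  simp [mulE, Matrix.sub_mulVec]

theorem neg_mulE (A : Matrix (Fin k) (Fin n) ℝ) (v : Vec n) : mulE (-A) v = -mulE A v := by
  simp [mulE, Matrix.neg_mulVec]

@[simp] theorem one_mulE (v : Vec n) : mulE (1 : Matrix (Fin n) (Fin n) ℝ) v = v := by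
  simp [mulE]

theorem mulE_mulE (A : Matrix (Fin k) (Fin l) ℝ) (B : Matrix (Fin l) (Fin n) ℝ) (v : Vec n) :
    mulE A (mulE B v) = mulE (A * B) v := by
  simp [mulE, Matrix.mulVec_mulVec]

theorem inner_mulE_left (A : Matrix (Fin k) (Fin n) ℝ) (v : Vec n) (w : Vec k) :
    inner ℝ (mulE A v) w = inner ℝ v (mulE Aᵀ w) := by
  simp only [mulE, EuclideanSpace.inner_eq_star_dotProduct, star_trivial]
  rw [Matrix.mulVec_transpose, ← Matrix.dotProduct_mulVec, dotProduct_comm]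

theorem inner_mulE_self_nonneg {A : Matrix (Fin n) (Fin n) ℝ} (hA : A.PosSemidef) (v : Vec n) :
    0 ≤ inner ℝ v (mulE A v) := by
  have := hA.dotProduct_mulVec_nonneg (WithLp.ofLp v)
  simpa [mulE, EuclideanSpace.inner_eq_star_dotProduct, dotProduct_comm] using this

theorem inner_mulE_self_pos {A : Matrix (Fin n) (Fin n) ℝ} (hA : A.PosDef) {v : Vec n}
    (hv : v ≠ 0) : 0 < inner ℝ v (mulE A v) := by
  have := hA.dotProduct_mulVec_pos (x := WithLp.ofLp v) (by simpa using hv)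
  simpa [mulE, EuclideanSpace.inner_eq_star_dotProduct, dotProduct_comm] using this

theorem inner_mulE_self_of_skew {A : Matrix (Fin n) (Fin n) ℝ} (hA : A = -Aᵀ) (v : Vec n) :
    inner ℝ v (mulE A v) = 0 := by
  have h1 : inner ℝ v (mulE A v) = inner ℝ (mulE Aᵀ v) v := by
    rw [inner_mulE_left, transpose_transpose]
  have h2 : Aᵀ = -A := by
    rw [hA, transpose_neg, transpose_transpose, ← hA]
  rw [h2, neg_mulE, inner_neg_left] at h1
  linarith [real_inner_comm v (mulE A v)]

theorem inner_mulE_sub_self {J R : Matrix (Fin n) (Fin n) ℝ} (hJ : J = -Jᵀ) (v : Vec n) :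
    inner ℝ v (mulE (J - R) v) = -inner ℝ v (mulE R v) := by
  rw [sub_mulE, inner_sub_right, inner_mulE_self_of_skew hJ, zero_sub]

theorem isUnit_det_skew_sub_posDef {J R : Matrix (Fin n) (Fin n) ℝ} (hJ : J = -Jᵀ)
    (hR : R.PosDef) : IsUnit (J - R).det := by
  rw [← Matrix.isUnit_iff_isUnit_det, ← Matrix.mulVec_injective_iff_isUnit]
  have hinj : Function.Injective (mulCLM (J - R)) := by
    refine (injective_iff_map_eq_zero _).2 fun v hv => ?_
    by_contra hne
    have h1 := inner_mulE_sub_self (R := R) hJ v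
    rw [mulCLM_apply] at hv
    rw [hv, inner_zero_right] at h1
    linarith [inner_mulE_self_pos hR hne]
  intro v w hvw
  exact (WithLp.toLp_injective 2) (hinj (congrArg (WithLp.toLp 2) hvw))

theorem ContDiff.mulE {V : Type*} [NormedAddCommGroup V] [NormedSpace ℝ V] {r : WithTop ℕ∞}
    {A : V → Matrix (Fin k) (Fin n) ℝ} {v : V → Vec n} (hA : ∀ i j, ContDiff ℝ r fun x => A x i j)
    (hv : ContDiff ℝ r v) : ContDiff ℝ r fun x => mulE (A x) (v x) := by
  rw [contDiff_euclidean] at hv ⊢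
  intro i
  simp only [_root_.mulE, Matrix.mulVec, dotProduct]
  exact ContDiff.sum fun j _ => (hA i j).mul (hv j)

end MulE

/-! ### Gradients -/

section Gradient

theorem gradient_eq_of_hasFDerivAt {F : Type*} [NormedAddCommGroup F] [InnerProductSpace ℝ F]
    [CompleteSpace F] {g : F → ℝ} {l : F →L[ℝ] ℝ} {x y : F} (hg : HasFDerivAt g l x)
    (hy : ∀ v, inner ℝ y v = l v) : gradient g x = y := by
  refine HasGradientAt.gradient (hasGradientAt_iff_hasFDerivAt.2 ?_)
  exact hg.congr_fderiv (ContinuousLinearMap.ext fun v => (hy v).symm)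

theorem inner_gradient {F : Type*} [NormedAddCommGroup F] [InnerProductSpace ℝ F]
    [CompleteSpace F] (g : F → ℝ) (x v : F) : inner ℝ (gradient g x) v = fderiv ℝ g x v := by
  simp [gradient]

end Gradient

/-! ### Partial gradients of the Hamiltonian -/

namespace PHPlant

variable {m p : ℕ} (S : PHPlant m p)

theorem differentiable_H : Differentiable ℝ S.H := S.smooth_H.differentiable (by simp)

theorem hasFDerivAt_H₁ (x : Vec m × Vec p) :
    HasFDerivAt (fun y : Vec m => S.H (y, x.2))
      ((fderiv ℝ S.H x).comp (ContinuousLinearMap.inl ℝ (Vec m) (Vec p))) x.1 :=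
  HasFDerivAt.comp x.1 (g := S.H) (f := fun y : Vec m => (y, x.2))
    (S.differentiable_H x).hasFDerivAt (hasFDerivAt_prodMk_left x.1 x.2)

theorem hasFDerivAt_H₂ (x : Vec m × Vec p) :
    HasFDerivAt (fun y : Vec p => S.H (x.1, y))
      ((fderiv ℝ S.H x).comp (ContinuousLinearMap.inr ℝ (Vec m) (Vec p))) x.2 :=
  HasFDerivAt.comp x.2 (g := S.H) (f := fun y : Vec p => (x.1, y))
    (S.differentiable_H x).hasFDerivAt (hasFDerivAt_prodMk_right x.1 x.2)

theorem inner_grad₁ (x : Vec m × Vec p) (v : Vec m) :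
    inner ℝ (S.grad₁ x) v = fderiv ℝ S.H x (v, 0) := by
  rw [grad₁, inner_gradient, (S.hasFDerivAt_H₁ x).fderiv]
  simp

theorem inner_grad₂ (x : Vec m × Vec p) (v : Vec p) :
    inner ℝ (S.grad₂ x) v = fderiv ℝ S.H x (0, v) := by
  rw [grad₂, inner_gradient, (S.hasFDerivAt_H₂ x).fderiv]
  simp

theorem fderiv_H_apply (x v : Vec m × Vec p) :
    fderiv ℝ S.H x v = inner ℝ (S.grad₁ x) v.1 + inner ℝ (S.grad₂ x) v.2 := by
  rw [inner_grad₁, inner_grad₂, ← map_add]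
  simp

theorem contDiff_fderiv_H : ContDiff ℝ ∞ (fderiv ℝ S.H) :=
  S.smooth_H.fderiv_right (by simp)

theorem contDiff_grad₁ : ContDiff ℝ ∞ S.grad₁ := by
  have h : S.grad₁ = fun x => (InnerProductSpace.toDual ℝ (Vec m)).symm
      ((fderiv ℝ S.H x).comp (ContinuousLinearMap.inl ℝ (Vec m) (Vec p))) := by
    funext x
    rw [grad₁, gradient, (S.hasFDerivAt_H₁ x).fderiv]
  rw [h]
  exact (InnerProductSpace.toDual ℝ (Vec m)).symm.contDiff.comp
    (S.contDiff_fderiv_H.clm_comp contDiff_const)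

theorem contDiff_grad₂ : ContDiff ℝ ∞ S.grad₂ := by
  have h : S.grad₂ = fun x => (InnerProductSpace.toDual ℝ (Vec p)).symm
      ((fderiv ℝ S.H x).comp (ContinuousLinearMap.inr ℝ (Vec m) (Vec p))) := by
    funext x
    rw [grad₂, gradient, (S.hasFDerivAt_H₂ x).fderiv]
  rw [h]
  exact (InnerProductSpace.toDual ℝ (Vec p)).symm.contDiff.comp
    (S.contDiff_fderiv_H.clm_comp contDiff_const)

variable {S}

theorem NoCrossTerm.grad₁_eq (h : S.NoCrossTerm) (x₁ : Vec m) (x₂ y₂ : Vec p) :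
    S.grad₁ (x₁, x₂) = S.grad₁ (x₁, y₂) := by
  have hd : Differentiable ℝ fun y : Vec p => S.grad₁ (x₁, y) :=
    (S.contDiff_grad₁.comp (contDiff_const.prodMk contDiff_id)).differentiable (by simp)
  exact is_const_of_fderiv_eq_zero hd (h x₁) x₂ y₂

/-- Without cross term `H` is a sum of a function of `x₁` and a function of `x₂`, so `∇_{x₂} H`
does not depend on `x₁` either. -/
theorem NoCrossTerm.grad₂_eq (h : S.NoCrossTerm) (x₁ y₁ : Vec m) (x₂ : Vec p) :
    S.grad₂ (x₁, x₂) = S.grad₂ (y₁, x₂) := by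
  have hsum : ∀ y : Vec p, S.H (x₁, y) = S.H (y₁, y) + (S.H (x₁, x₂) - S.H (y₁, x₂)) := by
    intro y
    have hd : ∀ z : Vec m, HasFDerivAt (fun z => S.H (z, y) - S.H (z, x₂))
        (0 : Vec m →L[ℝ] ℝ) z := by
      intro z
      refine HasFDerivAt.congr_fderiv
        ((S.hasFDerivAt_H₁ (z, y)).sub (S.hasFDerivAt_H₁ (z, x₂))) ?_
      ext v
      have h1 := S.inner_grad₁ (z, y) v
      rw [h.grad₁_eq z y x₂, S.inner_grad₁] at h1
      simp [h1]
    have := is_const_of_fderiv_eq_zero (fun z => (hd z).differentiableAt)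
      (fun z => (hd z).fderiv) x₁ y₁
    have h2 : S.H (x₁, y) - S.H (x₁, x₂) = S.H (y₁, y) - S.H (y₁, x₂) := this
    linarith
  have hfun : (fun y : Vec p => S.H (x₁, y)) =
      fun y => S.H (y₁, y) + (S.H (x₁, x₂) - S.H (y₁, x₂)) := funext hsum
  show gradient (fun y : Vec p => S.H (x₁, y)) x₂ = gradient (fun y : Vec p => S.H (y₁, y)) x₂
  rw [gradient, gradient, hfun, fderiv_add_const]

theorem StronglyConvex.strictConvexOn (h : S.StronglyConvex) : StrictConvexOn ℝ univ S.H := by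
  obtain ⟨μ, hμ, hH⟩ := h
  exact hH.strictConvexOn hμ

theorem eq_of_grad₁_eq (h : StrictConvexOn ℝ univ S.H) {x₁ y₁ : Vec m} {x₂ : Vec p}
    (he : S.grad₁ (x₁, x₂) = S.grad₁ (y₁, x₂)) : x₁ = y₁ := by
  have hs : StrictConvexOn ℝ univ fun u : Vec m => S.H (u, x₂) :=
    ⟨convex_univ, fun u _ v _ hne a b ha hb hab => by
      have := h.2 (mem_univ (u, x₂)) (mem_univ (v, x₂)) (by simpa using hne) ha hb hab
      simpa [← add_smul, hab] using this⟩
  refine hs.eq_of_hasFDerivAt (S.hasFDerivAt_H₁ (x₁, x₂))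
    ((S.hasFDerivAt_H₁ (y₁, x₂)).congr_fderiv ?_)
  ext w
  have h1 := S.inner_grad₁ (x₁, x₂) w
  rw [he, S.inner_grad₁] at h1
  simpa using h1

theorem eq_of_grad₂_eq (h : StrictConvexOn ℝ univ S.H) {x₁ : Vec m} {x₂ y₂ : Vec p}
    (he : S.grad₂ (x₁, x₂) = S.grad₂ (x₁, y₂)) : x₂ = y₂ := by
  have hs : StrictConvexOn ℝ univ fun u : Vec p => S.H (x₁, u) :=
    ⟨convex_univ, fun u _ v _ hne a b ha hb hab => by
      have := h.2 (mem_univ (x₁, u)) (mem_univ (x₁, v)) (by simpa using hne) ha hb hab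
      simpa [← add_smul, hab] using this⟩
  refine hs.eq_of_hasFDerivAt (S.hasFDerivAt_H₂ (x₁, x₂))
    ((S.hasFDerivAt_H₂ (x₁, y₂)).congr_fderiv ?_)
  ext w
  have h1 := S.inner_grad₂ (x₁, x₂) w
  rw [he, S.inner_grad₂] at h1
  simpa using h1

variable (S) in
/-- The strict minimum of `H` is a critical point. -/
theorem grad₂_min : S.grad₂ (S.x₁s, S.x₂s) = 0 := by
  have hmin : IsLocalMin S.H (S.x₁s, S.x₂s) := Eventually.of_forall fun x => by
    rcases eq_or_ne x (S.x₁s, S.x₂s) with rfl | hx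
    · exact le_rfl
    · exact (S.strict_min x hx).le
  refine ext_inner_right ℝ fun v => ?_
  rw [inner_grad₂, hmin.fderiv_eq_zero]
  simp

end PHPlant

/-! ### The closed loop and its shifted Hamiltonian -/

/-- The projection `(x₁, x₂, ζ) ↦ (x₁, x₂)` to the state of the plant. -/
noncomputable def plantState (m p : ℕ) : CLState m p →L[ℝ] Vec m × Vec p :=
  (ContinuousLinearMap.fst ℝ (Vec m) (Vec p × Vec p)).prod
    ((ContinuousLinearMap.fst ℝ (Vec p) (Vec p)).comp
      (ContinuousLinearMap.snd ℝ (Vec m) (Vec p × Vec p)))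

namespace IntegralController

variable {m p : ℕ} (C : IntegralController m p)

theorem differentiable_Hc : Differentiable ℝ C.Hc := C.contDiff_Hc.differentiable (by simp)

theorem contDiff_gradient_Hc : ContDiff ℝ 1 (gradient C.Hc) :=
  (InnerProductSpace.toDual ℝ (Vec p)).symm.contDiff.comp (C.contDiff_Hc.fderiv_right (by norm_num))

/-- The linear map `(x₁, x₂, ζ) ↦ Eᵀ x₁ - ζ`, the argument of `Hc` in the closed loop. -/
noncomputable def innerState : CLState m p →L[ℝ] Vec p :=
  (mulCLM C.Eᵀ).comp (ContinuousLinearMap.fst ℝ (Vec m) (Vec p × Vec p)) -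
    (ContinuousLinearMap.snd ℝ (Vec p) (Vec p)).comp
      (ContinuousLinearMap.snd ℝ (Vec m) (Vec p × Vec p))

@[simp] theorem innerState_apply (w : CLState m p) :
    C.innerState w = mulE C.Eᵀ w.1 - w.2.2 := rfl

end IntegralController

section ClosedLoop

variable {m p : ℕ} (S : PHPlant m p) (C : IntegralController m p)

theorem gradient_controller (x : Vec m) (ζ : Vec p) :
    gradient (fun y : Vec m => C.Hc (mulE C.Eᵀ y - ζ)) x =
      mulE C.E (gradient C.Hc (mulE C.Eᵀ x - ζ)) := by
  have h : HasFDerivAt (fun y : Vec m => C.Hc (mulE C.Eᵀ y - ζ))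
      ((fderiv ℝ C.Hc (mulE C.Eᵀ x - ζ)).comp (mulCLM C.Eᵀ)) x :=
    HasFDerivAt.comp x (g := C.Hc) (C.differentiable_Hc _).hasFDerivAt
      ((mulCLM C.Eᵀ).hasFDerivAt.sub_const ζ)
  refine gradient_eq_of_hasFDerivAt h fun v => ?_
  rw [inner_mulE_left, inner_gradient]
  rfl

/-- With `z = Eᵀ x₁ - ζ`, the first equation of the closed loop is
`ẋ₁ = (J₁ - R₁) (∇_{x₁} H + E ∇ Hc z) + J₁₂ ∇_{x₂} H - d₁`. -/
theorem closedLoop_eq (d₁ : Vec m) (w : CLState m p) :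
    closedLoop S C d₁ 0 w =
      (mulE (S.J₁ (w.1, w.2.1) - S.R₁ (w.1, w.2.1))
          (S.grad₁ (w.1, w.2.1) + mulE C.E (gradient C.Hc (C.innerState w))) +
        mulE (S.J₁₂ (w.1, w.2.1)) (S.grad₂ (w.1, w.2.1)) - d₁,
      mulE (-(S.J₁₂ (w.1, w.2.1))ᵀ) (S.grad₁ (w.1, w.2.1)) +
        mulE (S.J₂ (w.1, w.2.1) - S.R₂ (w.1, w.2.1)) (S.grad₂ (w.1, w.2.1)),
      mulE C.Eᵀ (mulE (S.J₁₂ (w.1, w.2.1)) (S.grad₂ (w.1, w.2.1)))) := by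
  simp only [closedLoop, PHPlant.field, controlLaw, gradient_controller, mulE_add, mulE_mulE,
    C.innerState_apply, sub_zero]
  congr 1
  abel

theorem contDiff_closedLoop (d₁ : Vec m) : ContDiff ℝ 1 (closedLoop S C d₁ 0) := by
  have hx : ContDiff ℝ 1 fun w : CLState m p => (w.1, w.2.1) := by fun_prop
  have h1 : ContDiff ℝ 1 fun w : CLState m p => S.grad₁ (w.1, w.2.1) :=
    (S.contDiff_grad₁.of_le (by simp)).comp hx
  have h2 : ContDiff ℝ 1 fun w : CLState m p => S.grad₂ (w.1, w.2.1) :=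
    (S.contDiff_grad₂.of_le (by simp)).comp hx
  have hc : ContDiff ℝ 1 fun w : CLState m p => gradient C.Hc (C.innerState w) :=
    C.contDiff_gradient_Hc.comp C.innerState.contDiff
  have hent : ∀ {k n : ℕ} {A : Vec m × Vec p → Matrix (Fin k) (Fin n) ℝ},
      (∀ i j, ContDiff ℝ ∞ fun x => A x i j) →
      ∀ i j, ContDiff ℝ 1 fun w : CLState m p => A (w.1, w.2.1) i j :=
    fun hA i j => ((hA i j).of_le (by simp)).comp hx
  have hJ₁₂ := ContDiff.mulE (hent S.smooth_J₁₂) h2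
  rw [show closedLoop S C d₁ 0 = _ from funext (closedLoop_eq S C d₁)]
  refine ContDiff.prodMk ?_ (ContDiff.prodMk ?_ ?_)
  · refine ((ContDiff.mulE (fun i j => ?_) (h1.add ?_)).add hJ₁₂).sub contDiff_const
    · exact (hent S.smooth_J₁ i j).sub (hent S.smooth_R₁ i j)
    · exact ContDiff.mulE (fun i j => contDiff_const) hc
  · refine (ContDiff.mulE (fun i j => ?_) h1).add (ContDiff.mulE (fun i j => ?_) h2)
    · exact (hent S.smooth_J₁₂ j i).neg
    · exact (hent S.smooth_J₂ i j).sub (hent S.smooth_R₂ i j)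
  · exact ContDiff.mulE (fun i j => contDiff_const) hJ₁₂

theorem gradHcl_eq (w : CLState m p) :
    gradHcl S C w = (S.grad₁ (w.1, w.2.1) + mulE C.E (gradient C.Hc (C.innerState w)),
      S.grad₂ (w.1, w.2.1), -gradient C.Hc (C.innerState w)) := by
  refine Prod.ext ?_ (Prod.ext ?_ ?_)
  · have h : HasFDerivAt (fun y : Vec m => C.Hc (mulE C.Eᵀ y - w.2.2))
        ((fderiv ℝ C.Hc (C.innerState w)).comp (mulCLM C.Eᵀ)) w.1 :=
      HasFDerivAt.comp w.1 (g := C.Hc) (C.differentiable_Hc _).hasFDerivAt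
        ((mulCLM C.Eᵀ).hasFDerivAt.sub_const w.2.2)
    refine gradient_eq_of_hasFDerivAt ((S.hasFDerivAt_H₁ (w.1, w.2.1)).add h) fun v => ?_
    rw [inner_add_left, S.inner_grad₁, inner_mulE_left, inner_gradient]
    rfl
  · refine gradient_eq_of_hasFDerivAt
      ((S.hasFDerivAt_H₂ (w.1, w.2.1)).add_const (C.Hc (C.innerState w))) fun v => ?_
    rw [S.inner_grad₂]
    rfl
  · have h : HasFDerivAt (fun y : Vec p => C.Hc (mulE C.Eᵀ w.1 - y))
        ((fderiv ℝ C.Hc (C.innerState w)).comp (-ContinuousLinearMap.id ℝ (Vec p))) w.2.2 :=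
      HasFDerivAt.comp w.2.2 (g := C.Hc) (C.differentiable_Hc _).hasFDerivAt
        ((hasFDerivAt_id w.2.2).const_sub (mulE C.Eᵀ w.1))
    refine gradient_eq_of_hasFDerivAt (h.const_add (S.H (w.1, w.2.1))) fun v => ?_
    rw [inner_neg_left, inner_gradient]
    simp

/-- The linear form `(x₁, x₂, ζ) ↦ ⟪h, ζ⟫ - ⟪b, x₁⟫`. -/
noncomputable def shiftForm (b : Vec m) (h : Vec p) : CLState m p →L[ℝ] ℝ :=
  (innerSL ℝ h).comp ((ContinuousLinearMap.snd ℝ (Vec p) (Vec p)).comp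
      (ContinuousLinearMap.snd ℝ (Vec m) (Vec p × Vec p))) -
    (innerSL ℝ b).comp (ContinuousLinearMap.fst ℝ (Vec m) (Vec p × Vec p))

theorem shiftForm_apply (b : Vec m) (h : Vec p) (w : CLState m p) :
    shiftForm b h w = inner ℝ h w.2.2 - inner ℝ b w.1 := rfl

/-- The closed-loop Hamiltonian shifted by a linear form so that its critical points are the
states at which `∇ Hcl = (b, 0, -h)`. -/
noncomputable def shiftedHcl (b : Vec m) (h : Vec p) (w : CLState m p) : ℝ :=
  Hcl S C w + shiftForm b h w

variable (b : Vec m) (h : Vec p)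

theorem hasFDerivAt_shiftedHcl (w : CLState m p) :
    HasFDerivAt (shiftedHcl S C b h) ((fderiv ℝ S.H (w.1, w.2.1)).comp (plantState m p) +
      (fderiv ℝ C.Hc (C.innerState w)).comp C.innerState + shiftForm b h) w := by
  refine HasFDerivAt.add (HasFDerivAt.add ?_ ?_) (shiftForm b h).hasFDerivAt
  · exact HasFDerivAt.comp w (g := S.H) (f := plantState m p) (S.differentiable_H _).hasFDerivAt
      (plantState m p).hasFDerivAt
  · exact HasFDerivAt.comp w (g := C.Hc) (C.differentiable_Hc _).hasFDerivAt
      C.innerState.hasFDerivAt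

theorem differentiable_shiftedHcl : Differentiable ℝ (shiftedHcl S C b h) :=
  fun w => (hasFDerivAt_shiftedHcl S C b h w).differentiableAt

theorem fderiv_shiftedHcl_apply (w v : CLState m p) :
    fderiv ℝ (shiftedHcl S C b h) w v =
      inner ℝ (S.grad₁ (w.1, w.2.1) + mulE C.E (gradient C.Hc (C.innerState w)) - b) v.1 +
        inner ℝ (S.grad₂ (w.1, w.2.1)) v.2.1 -
        inner ℝ (gradient C.Hc (C.innerState w) - h) v.2.2 := by
  rw [(hasFDerivAt_shiftedHcl S C b h w).fderiv]
  have h1 : fderiv ℝ S.H (w.1, w.2.1) (plantState m p v) = _ :=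
    S.fderiv_H_apply (w.1, w.2.1) (v.1, v.2.1)
  have h2 := inner_gradient C.Hc (C.innerState w) (C.innerState v)
  rw [C.innerState_apply v, inner_sub_right, ← inner_mulE_left] at h2
  simp only [_root_.add_apply, ContinuousLinearMap.comp_apply, inner_add_left, inner_sub_left, h1,
    shiftForm_apply, C.innerState_apply v, ← h2]
  ring

theorem strictConvexOn_shiftedHcl (hH : StrictConvexOn ℝ univ S.H) :
    StrictConvexOn ℝ univ (shiftedHcl S C b h) := by
  have hcl : StrictConvexOn ℝ univ (Hcl S C) := by
    refine ⟨convex_univ, fun w _ w' _ hne s t hs ht hst => ?_⟩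
    have e1 : ((s • w + t • w').1, (s • w + t • w').2.1) =
        s • (w.1, w.2.1) + t • (w'.1, w'.2.1) := rfl
    have e2 : mulE C.Eᵀ (s • w + t • w').1 - (s • w + t • w').2.2 =
        s • C.innerState w + t • C.innerState w' := by
      rw [← C.innerState_apply, map_add, map_smul, map_smul]
    have hc := C.strictConvex_Hc.convexOn.2 (mem_univ (C.innerState w))
      (mem_univ (C.innerState w')) hs.le ht.le hst
    simp only [Hcl, e1, e2, smul_eq_mul] at hc ⊢
    rw [← C.innerState_apply w, ← C.innerState_apply w']
    by_cases hx : (w.1, w.2.1) = (w'.1, w'.2.1)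
    · have hz : C.innerState w ≠ C.innerState w' := by
        intro hz
        apply hne
        simp only [Prod.mk.injEq] at hx
        rw [C.innerState_apply, C.innerState_apply, hx.1] at hz
        exact Prod.ext hx.1 (Prod.ext hx.2 (sub_right_injective hz))
      have hc' := C.strictConvex_Hc.2 (mem_univ _) (mem_univ _) hz hs ht hst
      rw [← hx, ← add_smul, hst, one_smul]
      simp only [smul_eq_mul] at hc'
      have : S.H (w.1, w.2.1) = s * S.H (w.1, w.2.1) + t * S.H (w.1, w.2.1) := by
        rw [← add_mul, hst, one_mul]
      linarith
    · have hh := hH.2 (mem_univ _) (mem_univ _) hx hs ht hst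
      simp only [smul_eq_mul] at hh
      linarith
  exact hcl.add_convexOn ((shiftForm b h).toLinearMap.convexOn convex_univ)

theorem gradHcl_eq_iff (w : CLState m p) :
    gradHcl S C w = (b, 0, -h) ↔ fderiv ℝ (shiftedHcl S C b h) w = 0 := by
  rw [gradHcl_eq]
  constructor
  · intro he
    simp only [Prod.mk.injEq, neg_inj] at he
    refine ContinuousLinearMap.ext fun v => ?_
    rw [fderiv_shiftedHcl_apply, he.1, he.2.1, he.2.2]
    simp
  · intro he
    have hv : ∀ v, _ = (0 : ℝ) := fun v =>
      (fderiv_shiftedHcl_apply S C b h w v).symm.trans (by rw [he]; rfl)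
    refine Prod.ext ?_ (Prod.ext ?_ ?_)
    · exact sub_eq_zero.1 (ext_inner_right ℝ fun v => by simpa using hv (v, 0, 0))
    · exact ext_inner_right ℝ fun v => by simpa using hv (0, v, 0)
    · exact neg_inj.2 (sub_eq_zero.1 (ext_inner_right ℝ fun v => by simpa using hv (0, 0, v)))

end ClosedLoop

/-! ### Dissipation and invariance -/

section Stability

variable {m p : ℕ} {S : PHPlant m p} {C : IntegralController m p}

theorem isUnit_det_transpose_mul (hEunit : ∀ x, IsUnit (C.Eᵀ * S.J₁₂ x)) (x : Vec m × Vec p) :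
    IsUnit ((S.J₁₂ x)ᵀ * C.E).det := by
  have h1 := (Matrix.isUnit_iff_isUnit_det _).1 (hEunit x)
  rwa [← det_transpose, transpose_mul, transpose_transpose] at h1

theorem leftInv_mul_E (hEunit : ∀ x, IsUnit (C.Eᵀ * S.J₁₂ x)) (x : Vec m × Vec p) :
    leftInv S C x * C.E = 1 := by
  rw [leftInv, Matrix.mul_assoc, Matrix.nonsing_inv_mul _ (isUnit_det_transpose_mul hEunit x)]

/-- `E L` acts as the identity under `J₁₂ᵀ`, where `L = (J₁₂ᵀ E)⁻¹ J₁₂ᵀ`. -/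
theorem mulE_transpose_mulE_leftInv (hEunit : ∀ x, IsUnit (C.Eᵀ * S.J₁₂ x))
    (x : Vec m × Vec p) (v : Vec m) :
    mulE (S.J₁₂ x)ᵀ (mulE C.E (mulE (leftInv S C x) v)) = mulE (S.J₁₂ x)ᵀ v := by
  rw [leftInv, mulE_mulE, mulE_mulE,
    Matrix.mul_nonsing_inv_cancel_left _ _ (isUnit_det_transpose_mul hEunit x)]

/-- The dissipation identity of the shifted closed-loop Hamiltonian. The terms in `J₁₂` cancel
because `E L` acts as the identity under `J₁₂ᵀ`, where `L` is the left inverse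
`(J₁₂ᵀ E)⁻¹ J₁₂ᵀ` of `E`. -/
theorem fderiv_shiftedHcl_closedLoop (hEunit : ∀ x, IsUnit (C.Eᵀ * S.J₁₂ x)) {d₁ b : Vec m}
    {h : Vec p} {w : CLState m p}
    (hb : mulE (S.J₁ (w.1, w.2.1) - S.R₁ (w.1, w.2.1)) b = d₁)
    (hh : h = mulE (leftInv S C (w.1, w.2.1)) b) :
    fderiv ℝ (shiftedHcl S C b h) w (closedLoop S C d₁ 0 w) =
      -inner ℝ (S.grad₁ (w.1, w.2.1) + mulE C.E (gradient C.Hc (C.innerState w)) - b)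
          (mulE (S.R₁ (w.1, w.2.1))
            (S.grad₁ (w.1, w.2.1) + mulE C.E (gradient C.Hc (C.innerState w)) - b)) -
        inner ℝ (S.grad₂ (w.1, w.2.1)) (mulE (S.R₂ (w.1, w.2.1)) (S.grad₂ (w.1, w.2.1))) := by
  have hEh : mulE (S.J₁₂ (w.1, w.2.1))ᵀ (mulE C.E h) = mulE (S.J₁₂ (w.1, w.2.1))ᵀ b := by
    rw [hh, mulE_transpose_mulE_leftInv hEunit]
  rw [fderiv_shiftedHcl_apply, closedLoop_eq]
  set g₁ := S.grad₁ (w.1, w.2.1)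
  set g₂ := S.grad₂ (w.1, w.2.1)
  set c := gradient C.Hc (C.innerState w)
  set A := S.J₁₂ (w.1, w.2.1)
  have e1 : mulE (S.J₁ (w.1, w.2.1) - S.R₁ (w.1, w.2.1)) (g₁ + mulE C.E c) + mulE A g₂ - d₁ =
      mulE (S.J₁ (w.1, w.2.1) - S.R₁ (w.1, w.2.1)) (g₁ + mulE C.E c - b) + mulE A g₂ := by
    rw [mulE_sub _ _ b, hb]
    abel
  have e2 : inner ℝ g₂ (mulE (-Aᵀ) g₁) = -inner ℝ g₁ (mulE A g₂) := by
    rw [neg_mulE, inner_neg_right, real_inner_comm, inner_mulE_left, transpose_transpose]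
  have e3 : inner ℝ (c - h) (mulE C.Eᵀ (mulE A g₂)) =
      inner ℝ (mulE C.E c) (mulE A g₂) - inner ℝ b (mulE A g₂) := by
    have e4 : inner ℝ (mulE C.E h) (mulE A g₂) = inner ℝ b (mulE A g₂) := by
      rw [← transpose_transpose A, ← inner_mulE_left, ← inner_mulE_left, hEh]
    rw [← inner_mulE_left, mulE_sub, inner_sub_left, e4]
  simp only [e1, e2, e3, inner_add_right, inner_mulE_sub_self (S.skew_J₁ _),
    inner_mulE_sub_self (S.skew_J₂ _), inner_add_left, inner_sub_left]
  ring

/-- The invariance argument: a solution without dissipation starts at a critical point of the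
shifted Hamiltonian. -/
theorem fderiv_shiftedHcl_eq_zero_of_const (hH : StrictConvexOn ℝ univ S.H)
    (hcross : S.NoCrossTerm) (hEunit : ∀ x, IsUnit (C.Eᵀ * S.J₁₂ x)) {d₁ b : Vec m}
    {h : Vec p} (hb : ∀ x, mulE (S.J₁ x - S.R₁ x) b = d₁)
    (hh : ∀ x, h = mulE (leftInv S C x) b) {φ : ℝ → CLState m p}
    (hφ : IsForwardSolution (closedLoop S C d₁ 0) φ)
    (hconst : ∀ t, 0 ≤ t → shiftedHcl S C b h (φ t) = shiftedHcl S C b h (φ 0)) :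
    fderiv ℝ (shiftedHcl S C b h) (φ 0) = 0 := by
  -- The dissipation in `x₁` vanishes.
  have hq : ∀ t, 0 ≤ t → S.grad₁ ((φ t).1, (φ t).2.1) +
      mulE C.E (gradient C.Hc (C.innerState (φ t))) - b = 0 := by
    intro t ht
    by_contra hne
    have h0 := hφ.fderiv_apply_eq_zero (differentiable_shiftedHcl S C b h) hconst ht
    rw [fderiv_shiftedHcl_closedLoop hEunit (hb _) (hh _)] at h0
    linarith [inner_mulE_self_pos (S.posDef_R₁ ((φ t).1, (φ t).2.1)) hne,
      inner_mulE_self_nonneg (S.posSemidef_R₂ ((φ t).1, (φ t).2.1))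
        (S.grad₂ ((φ t).1, (φ t).2.1))]
  have hfield : ∀ t, 0 ≤ t → closedLoop S C d₁ 0 (φ t) =
      (mulE (S.J₁₂ ((φ t).1, (φ t).2.1)) (S.grad₂ ((φ t).1, (φ t).2.1)),
        mulE (-(S.J₁₂ ((φ t).1, (φ t).2.1))ᵀ) (S.grad₁ ((φ t).1, (φ t).2.1)) +
          mulE (S.J₂ ((φ t).1, (φ t).2.1) - S.R₂ ((φ t).1, (φ t).2.1))
            (S.grad₂ ((φ t).1, (φ t).2.1)),
        mulE C.Eᵀ (mulE (S.J₁₂ ((φ t).1, (φ t).2.1)) (S.grad₂ ((φ t).1, (φ t).2.1)))) := by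
    intro t ht
    rw [closedLoop_eq, sub_eq_zero.1 (hq t ht), hb, add_sub_cancel_left]
  -- Hence the argument of `Hc` is constant, and so are `∇_{x₁} H` and `x₁`.
  have hz : ∀ t, 0 ≤ t → C.innerState (φ t) = C.innerState (φ 0) := fun t ht =>
    hφ.map_eq_of_map_field_eq_zero C.innerState (fun s hs => by simp [hfield s hs]) ht
  have hx₁ : ∀ t, 0 ≤ t → (φ t).1 = (φ 0).1 := fun t ht => by
    have h1 := hq t ht
    rw [hz t ht, ← hq 0 le_rfl, sub_left_inj, add_left_inj,
      hcross.grad₁_eq _ _ (φ 0).2.1] at h1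
    exact S.eq_of_grad₁_eq hH h1
  -- So `J₁₂ ∇_{x₂} H = 0`, which gives `∇_{x₂} H = 0` and makes `x₂` constant.
  have hg₂ : ∀ t, 0 ≤ t → S.grad₂ ((φ t).1, (φ t).2.1) = 0 := fun t ht => by
    have h1 := hφ.map_field_eq_zero (ContinuousLinearMap.fst ℝ (Vec m) (Vec p × Vec p)) hx₁ ht
    rw [hfield t ht, ContinuousLinearMap.coe_fst'] at h1
    have h2 := congrArg (mulE ((C.Eᵀ * S.J₁₂ ((φ t).1, (φ t).2.1))⁻¹ * C.Eᵀ)) h1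
    rwa [mulE_mulE, Matrix.mul_assoc, Matrix.nonsing_inv_mul _
      ((Matrix.isUnit_iff_isUnit_det _).1 (hEunit _)), one_mulE, mulE_zero] at h2
  have hx₂ : ∀ t, 0 ≤ t → (φ t).2.1 = (φ 0).2.1 := fun t ht => by
    have h1 := (hg₂ t ht).trans (hg₂ 0 le_rfl).symm
    rw [hx₁ t ht] at h1
    exact S.eq_of_grad₂_eq hH h1
  -- Now `J₁₂ᵀ ∇_{x₁} H = 0`, so that the left inverse of `E` recovers `∇ Hc` from `hq`.
  have hg₁ : mulE (leftInv S C ((φ 0).1, (φ 0).2.1)) (S.grad₁ ((φ 0).1, (φ 0).2.1)) = 0 := by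
    have h1 := hφ.map_field_eq_zero ((ContinuousLinearMap.fst ℝ (Vec p) (Vec p)).comp
      (ContinuousLinearMap.snd ℝ (Vec m) (Vec p × Vec p))) hx₂ (le_refl 0)
    rw [hfield 0 le_rfl, hg₂ 0 le_rfl] at h1
    simp only [ContinuousLinearMap.comp_apply, ContinuousLinearMap.coe_fst',
      ContinuousLinearMap.coe_snd', mulE_zero, add_zero, neg_mulE, neg_eq_zero] at h1
    rw [leftInv, ← mulE_mulE, h1, mulE_zero]
  have hc : gradient C.Hc (C.innerState (φ 0)) = h := by
    have h1 := congrArg (mulE (leftInv S C ((φ 0).1, (φ 0).2.1))) (hq 0 le_rfl)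
    rw [mulE_sub, mulE_add, hg₁, zero_add, mulE_mulE, leftInv_mul_E hEunit, one_mulE, mulE_zero,
      ← hh, sub_eq_zero] at h1
    exact h1
  rw [← gradHcl_eq_iff, gradHcl_eq, sub_eq_zero.1 (hq 0 le_rfl), hg₂ 0 le_rfl, hc]

end Stability

/-! ### Stability of the equilibrium -/

theorem proposition1 {m p : ℕ} (S : PHPlant m p) (C : IntegralController m p) (d₁ : Vec m)
    (hJ₁₂ : ∀ x, (S.J₁₂ x).rank = p)
    (hR₁ : ∀ x, (S.R₁ x).rank = m)
    (hcross : S.NoCrossTerm)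
    (hconv : S.StronglyConvex)
    (hJ₁const : ∀ x y, S.J₁ x = S.J₁ y)
    (hR₁const : ∀ x y, S.R₁ x = S.R₁ y)
    (xbar₁ : Vec m)
    (hEunit : ∀ x, IsUnit (C.Eᵀ * S.J₁₂ x))
    (hE : ∀ x, leftInv S C (xbar₁, S.x₂s) = leftInv S C x)
    (heq : EquilibriumEquation S C d₁ xbar₁)
    (huniq : ∀ y : Vec m, EquilibriumEquation S C d₁ y → y = xbar₁) :
    ∃ ζbar : Vec p,
      (∀ w : CLState m p,
        gradHcl S C w = equilibriumGradient S C d₁ (xbar₁, S.x₂s) ↔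
          w = (xbar₁, S.x₂s, ζbar)) ∧
      GloballyAsymptoticallyStable (closedLoop S C d₁ 0) (xbar₁, S.x₂s, ζbar) ∧
      ∀ w : ℝ → CLState m p, IsForwardSolution (closedLoop S C d₁ 0) w →
        Tendsto (fun t => S.grad₂ ((w t).1, (w t).2.1)) atTop (𝓝 0) := by
  have hH := hconv.strictConvexOn
  set b : Vec m := mulE (S.J₁ (xbar₁, S.x₂s) - S.R₁ (xbar₁, S.x₂s))⁻¹ d₁ with hbdef
  set h : Vec p := mulE (leftInv S C (xbar₁, S.x₂s)) b with hhdef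
  have hb : ∀ x, mulE (S.J₁ x - S.R₁ x) b = d₁ := fun x => by
    rw [hJ₁const x (xbar₁, S.x₂s), hR₁const x (xbar₁, S.x₂s), hbdef, mulE_mulE,
      Matrix.mul_nonsing_inv _ (isUnit_det_skew_sub_posDef (S.skew_J₁ _) (S.posDef_R₁ _)),
      one_mulE]
  have hh : ∀ x, h = mulE (leftInv S C x) b := fun x => by rw [hhdef, hE x]
  have hG : equilibriumGradient S C d₁ (xbar₁, S.x₂s) = (b, 0, -h) := by
    rw [equilibriumGradient, hhdef, hbdef, mulE_mulE]
  obtain ⟨z, hz⟩ := C.bijective_grad.surjective h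
  set a : CLState m p := (xbar₁, S.x₂s, mulE C.Eᵀ xbar₁ - z) with ha
  have hinner : C.innerState a = z := by simp [ha]
  have hg₁ : S.grad₁ (xbar₁, S.x₂s) = b - mulE C.E h := by
    have h1 : S.grad₁ (xbar₁, S.x₂s) = _ := heq
    rw [h1, ← mulE_mulE, ← hbdef, sub_mulE, one_mulE, ← mulE_mulE]
  have hg₂ : S.grad₂ (xbar₁, S.x₂s) = 0 := (hcross.grad₂_eq _ S.x₁s _).trans S.grad₂_min
  have hcrit : fderiv ℝ (shiftedHcl S C b h) a = 0 := by
    rw [← gradHcl_eq_iff, gradHcl_eq, hinner, hz]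
    simp only [ha, hg₁, hg₂, sub_add_cancel]
  have hdiff := differentiable_shiftedHcl S C b h
  have hconvW := strictConvexOn_shiftedHcl S C b h hH
  have hda : HasFDerivAt (shiftedHcl S C b h) (0 : CLState m p →L[ℝ] ℝ) a :=
    hcrit ▸ (hdiff a).hasFDerivAt
  have hcritEq : ∀ w, fderiv ℝ (shiftedHcl S C b h) w = 0 → w = a := fun w hw =>
    hconvW.eq_of_hasFDerivAt (hw ▸ (hdiff w).hasFDerivAt) hda
  have hfa : closedLoop S C d₁ 0 a = 0 := by
    have hJg : mulE (S.J₁₂ (xbar₁, S.x₂s))ᵀ (S.grad₁ (xbar₁, S.x₂s)) = 0 := by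
      rw [hg₁, hhdef, mulE_sub, mulE_transpose_mulE_leftInv hEunit, sub_self]
    rw [closedLoop_eq, hinner, hz]
    simp only [ha, neg_mulE, hJg, hg₂]
    simp [hg₁, hb]
  have hmin : ∀ w, w ≠ a → shiftedHcl S C b h a < shiftedHcl S C b h w := fun w hw =>
    hconvW.lt_of_hasFDerivAt_zero hda hw
  have hstable : GloballyAsymptoticallyStable (closedLoop S C d₁ 0) a := by
    refine globallyAsymptoticallyStable_of_lyapunov (contDiff_closedLoop S C d₁) hfa hdiff
      (hconvW.convexOn.isBounded_sublevel hdiff.continuous hmin) hmin (fun w => ?_)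
      fun φ hφ hc => hcritEq _
        (fderiv_shiftedHcl_eq_zero_of_const hH hcross hEunit hb hh hφ hc)
    rw [fderiv_shiftedHcl_closedLoop hEunit (hb _) (hh _)]
    linarith [inner_mulE_self_nonneg (S.posDef_R₁ (w.1, w.2.1)).posSemidef
        (S.grad₁ (w.1, w.2.1) + mulE C.E (gradient C.Hc (C.innerState w)) - b),
      inner_mulE_self_nonneg (S.posSemidef_R₂ (w.1, w.2.1)) (S.grad₂ (w.1, w.2.1))]
  refine ⟨mulE C.Eᵀ xbar₁ - z, fun w => ?_, hstable, fun w hw => ?_⟩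
  · rw [hG, gradHcl_eq_iff]
    exact ⟨hcritEq w, fun hw => hw ▸ hcrit⟩
  · have hcont : Continuous fun w : CLState m p => S.grad₂ (w.1, w.2.1) :=
      S.contDiff_grad₂.continuous.comp (by fun_prop)
    have := (hcont.tendsto a).comp (hstable.2.2.2 w hw)
    rwa [show S.grad₂ (a.1, a.2.1) = 0 from hg₂] at this
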